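/- **Definitions.** A lattice simplex of dimension $d$ in $\mathbb{R}^d$ is the convex hull $\Delta$ of $d+1$ affinely independent points $v_0,\dots,v_d\in\mathbb{Z}^d$. Its $\delta$-polynomial is $$\delta(\Delta,t)=(1-t)^{d+1}\Bigl(1+\sum_{n\ge 1}|n\Delta\cap\mathbb{Z}^d|\,t^n\Bigr),$$ and $$\Lambda_\Delta=\Bigl\{(\lambda_0,\dots,\lambda_d)\in(\mathbb{R}/\mathbb{Z})^{d+1}:\ \sum_{i=0}^d\lambda_i\,(v_i,1)\in\mathbb{Z}^{d+1}\Bigr\}.$$ For $d\ge 1$, $\Delta$ is called a lattice pyramid if there is a lattice simplex $\Delta'\subset\mathbb{R}^{d-1}$ of dimension $d-1$ such that $\Delta$ is unimodularly equivalent to $\operatorname{conv}(\Delta'\times\{0\},(0,\dots,0,1))\subset\mathbb{R}^d$, that is, equal to it up to a map $x\mapsto xU+w$ with $U\in\mathbb{Z}^{d\times d}$, $\det U=\pm1$, $w\in\mathbb{Z}^d$. **Theorem.** Let $v>0$ and $k\ge 0$ be integers. Then there exist $d\ge 0$ and a lattice simplex $\Delta\subset\mathbb{R}^d$ of dimension $d$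 with $$\delta(\Delta,t)=1+t^{k+1}+t^{2(k+1)}+\cdots+t^{(v-1)(k+1)}.\qquad(*)$$ Furthermore, let $d\ge 1$ and let $\Delta\subset\mathbb{R}^d$ be any lattice simplex of dimension $d$ that satisfies $(*)$ and is not a lattice pyramid. Then $$v(k+1)-1\ \le\ d\ \le\ 4(v-1)(k+1)-2,$$ and $d=v(k+1)-1$ holds if and only if $\Lambda_\Delta$ is generated by the single element $(1/v,\dots,1/v)\in(\mathbb{R}/\mathbb{Z})^{d+1}$. -/

import Mathlib

open scoped Pointwise

/-- The full-dimensional simplex `s` in `ℝ^d` is a lattice simplex: its vertices `v₀, …, v_d`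
have integer coordinates. (Affine independence of the vertices is part of `Affine.Simplex`.) -/
def IsLatticeSimplex {d : ℕ} (s : Affine.Simplex ℝ (Fin d → ℝ) d) : Prop :=
  ∀ i j, ∃ z : ℤ, s.points i j = (z : ℝ)

/-- The convex polytope spanned by the vertices of a simplex. -/
def simplexHull {d : ℕ} (s : Affine.Simplex ℝ (Fin d → ℝ) d) : Set (Fin d → ℝ) :=
  convexHull ℝ (Set.range s.points)

/-- The number `|nP ∩ ℤ^d|` of lattice points in the `n`-th dilate of `P`. -/
noncomputable def latticePointCount {d : ℕ} (P : Set (Fin d → ℝ)) (n : ℕ) : ℕ :=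
  Set.ncard {z : Fin d → ℤ | (fun j => (z j : ℝ)) ∈ (n : ℝ) • P}

/-- The Ehrhart series `1 + ∑_{n ≥ 1} |nP ∩ ℤ^d| t^n`. -/
noncomputable def ehrhartSeries {d : ℕ} (P : Set (Fin d → ℝ)) : PowerSeries ℤ :=
  PowerSeries.mk fun n => if n = 0 then 1 else (latticePointCount P n : ℤ)

/-- The `δ`-polynomial `δ(P, t) = (1 - t)^{d+1} (1 + ∑_{n ≥ 1} |nP ∩ ℤ^d| t^n)` of a
`d`-dimensional lattice polytope `P` in `ℝ^d`, as a formal power series. -/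
noncomputable def deltaSeries {d : ℕ} (P : Set (Fin d → ℝ)) : PowerSeries ℤ :=
  (1 - PowerSeries.X) ^ (d + 1) * ehrhartSeries P

/-- The group `Λ_Δ` of all `(λ₀, …, λ_d) ∈ (ℝ/ℤ)^{d+1}` with `∑ λᵢ (vᵢ, 1) ∈ ℤ^{d+1}`. For integral
`vᵢ` the condition does not depend on the real representatives `rᵢ` of the `λᵢ`. -/
def simplexGroup {d : ℕ} (s : Affine.Simplex ℝ (Fin d → ℝ) d) :
    AddSubgroup (Fin (d + 1) → UnitAddCircle) where
  carrier := {l | ∃ r : Fin (d + 1) → ℝ, (∀ i, (r i : UnitAddCircle) = l i) ∧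
    (∀ j, ∃ z : ℤ, ∑ i, r i * s.points i j = (z : ℝ)) ∧ ∃ z : ℤ, ∑ i, r i = (z : ℝ)}
  zero_mem' := ⟨0, by simp, fun j => ⟨0, by simp⟩, 0, by simp⟩
  add_mem' := by
    rintro a b ⟨r, hr, h1, z, hz⟩ ⟨r', hr', h1', z', hz'⟩
    refine ⟨r + r', fun i => by simp [← hr, ← hr'], fun j => ?_, z + z', ?_⟩
    · obtain ⟨x, hx⟩ := h1 j
      obtain ⟨y, hy⟩ := h1' j
      exact ⟨x + y, by simp [add_mul, Finset.sum_add_distrib, hx, hy]⟩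
    · simp [Finset.sum_add_distrib, hz, hz']
  neg_mem' := by
    rintro a ⟨r, hr, h1, z, hz⟩
    refine ⟨-r, fun i => by simp [← hr], fun j => ?_, -z, ?_⟩
    · obtain ⟨x, hx⟩ := h1 j
      exact ⟨-x, by simp [hx]⟩
    · simp [hz]

/-- Unimodular equivalence in `ℝ^d`: `Q = P U + w` with `U` an integer matrix of determinant
`±1` and `w` an integer vector. -/
def UnimodularlyEquivalent {d : ℕ} (P Q : Set (Fin d → ℝ)) : Prop :=
  ∃ (U : Matrix (Fin d) (Fin d) ℤ) (w : Fin d → ℤ), (U.det = 1 ∨ U.det = -1) ∧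
    Q = (fun x => Matrix.vecMul x (U.map (fun a => (a : ℝ))) + fun j => (w j : ℝ)) '' P

/-- The lattice pyramid `Pyr(P) = conv(P × {0}, (0, …, 0, 1))` in `ℝ^{d+1}`. -/
def latticePyramid {d : ℕ} (P : Set (Fin d → ℝ)) : Set (Fin (d + 1) → ℝ) :=
  convexHull ℝ ((fun x => Fin.snoc (α := fun _ => ℝ) x 0) '' P ∪
    {Fin.snoc (α := fun _ => ℝ) 0 1})

/-- A subset of `ℝ^d` is a lattice pyramid over a lower-dimensional lattice simplex: up to
unimodular equivalence, it is `Pyr(Δ')` for a lattice simplex `Δ'` of dimension `d - 1`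
(an iterated pyramid is also of this form). A point, in `ℝ^0`, is not such a pyramid. -/
def IsLatticePyramid : {d : ℕ} → Set (Fin d → ℝ) → Prop
  | 0, _ => False
  | e + 1, Q => ∃ s : Affine.Simplex ℝ (Fin e → ℝ) e, IsLatticeSimplex s ∧
      UnimodularlyEquivalent Q (latticePyramid (simplexHull s))

/-!
Splitting a point of the cone over `Δ` into its fractional and its integral part along the vertices
gives `δ(Δ, t) = ∑ t ^ height λ`, summed over `λ ∈ Λ_Δ`, where `height λ = ∑ {λᵢ}`. Pairing `λ`
with `-λ`, twice the sum of all the heights is `∑ᵢ (|Λ_Δ| - |Kᵢ|)`, where `Kᵢ` is the kernel of the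
`i`-th coordinate on `Λ_Δ`. For `δ = 1 + t^(k+1) + ⋯ + t^((v-1)(k+1))` the order of `Λ_Δ` is `v` and
twice the sum of the heights is `v (v - 1) (k + 1)`. Then `|Kᵢ| ≥ 1` is the lower bound on `d`, with
equality when all the `Kᵢ` are trivial. In that case the element of height `k + 1` has all its
coordinates at least `1/v`, hence equal to `1/v`.

If `Kᵢ = Λ_Δ`, the `i`-th barycentric coordinate is integral on `ℤ^d`, and `Δ` is a pyramid with the
`i`-th vertex as its apex. Otherwise `|Kᵢ| ≤ v / 2`, and this yields `d ≤ 2 (v - 1) (k + 1) - 1`,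
which sharpens the upper bound.
-/

/-- The representative in `[0, 1)` of an element of `ℝ/ℤ`. -/
noncomputable def circleFract (x : UnitAddCircle) : ℝ := AddCircle.equivIco 1 0 x

lemma coe_circleFract (x : UnitAddCircle) : (circleFract x : UnitAddCircle) = x :=
  AddCircle.coe_equivIco

lemma circleFract_coe (r : ℝ) : circleFract r = Int.fract r :=
  (AddCircle.coe_equivIco_mk_apply (p := (1 : ℝ)) r).trans (by simp)

lemma fract_circleFract (x : UnitAddCircle) : Int.fract (circleFract x) = circleFract x := by
  rw [← circleFract_coe, coe_circleFract]

lemma circleFract_nonneg (x : UnitAddCircle) : 0 ≤ circleFract x :=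
  fract_circleFract x ▸ Int.fract_nonneg _

lemma circleFract_lt_one (x : UnitAddCircle) : circleFract x < 1 :=
  fract_circleFract x ▸ Int.fract_lt_one _

lemma circleFract_eq_zero_iff {x : UnitAddCircle} : circleFract x = 0 ↔ x = 0 := by
  refine ⟨fun h => ?_, ?_⟩
  · rw [← coe_circleFract x, h, AddCircle.coe_zero]
  · rintro rfl
    simpa using circleFract_coe 0

lemma circleFract_add_circleFract_neg (x : UnitAddCircle) :
    circleFract x + circleFract (-x) = if x = 0 then 0 else 1 := by
  split_ifs with h
  · simp [h, circleFract_eq_zero_iff.2 rfl]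
  · have hfract : Int.fract (circleFract x) ≠ 0 := by
      rwa [fract_circleFract, Ne, circleFract_eq_zero_iff]
    have hneg : circleFract (-x) = Int.fract (-circleFract x) := by
      rw [← circleFract_coe, AddCircle.coe_neg, coe_circleFract]
    rw [hneg, Int.fract_neg hfract, fract_circleFract, add_sub_cancel]

lemma coe_unitAddCircle_eq_iff {r t : ℝ} : (r : UnitAddCircle) = t ↔ ∃ z : ℤ, r - t = z := by
  rw [← sub_eq_zero, ← AddCircle.coe_sub, AddCircle.coe_eq_zero_iff]
  simp [eq_comm]

lemma coe_circleFract_add_natCast (x : UnitAddCircle) (n : ℕ) :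
    ((circleFract x + n : ℝ) : UnitAddCircle) = x := by
  rw [AddCircle.coe_add, coe_circleFract, add_eq_left, AddCircle.coe_eq_zero_iff]
  exact ⟨n, by simp⟩

lemma floor_circleFract_add_natCast (x : UnitAddCircle) (n : ℕ) : ⌊circleFract x + n⌋₊ = n := by
  rw [Nat.floor_add_natCast (circleFract_nonneg x), Nat.floor_eq_zero.2 (circleFract_lt_one x),
    zero_add]

lemma circleFract_coe_add_floor {r : ℝ} (hr : 0 ≤ r) : circleFract r + ⌊r⌋₊ = r := by
  rw [circleFract_coe, natCast_floor_eq_intCast_floor hr, Int.fract_add_floor]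

lemma one_div_le_circleFract {n : ℕ} {x : UnitAddCircle} (hn : n • x = 0) (hx : x ≠ 0) :
    1 / (n : ℝ) ≤ circleFract x := by
  have hpos : 0 < circleFract x :=
    (circleFract_nonneg x).lt_of_ne' (circleFract_eq_zero_iff.not.2 hx)
  obtain ⟨m, hm⟩ : ∃ m : ℤ, (m : ℝ) = n * circleFract x := by
    rw [← coe_circleFract x, ← AddCircle.coe_nsmul, AddCircle.coe_eq_zero_iff] at hn
    simpa using hn
  rcases n.eq_zero_or_pos with rfl | hn0
  · simpa using hpos.le
  · have hm0 : 0 < m := by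
      have : (0 : ℝ) < m := by rw [hm]; positivity
      exact_mod_cast this
    have hm1 : (1 : ℝ) ≤ m := by exact_mod_cast hm0
    rw [div_le_iff₀ (by positivity)]
    linarith

section Age

variable {ι : Type*} {G : AddSubgroup (ι → UnitAddCircle)}

/-- The elements of a subgroup of the torus whose `i`-th coordinate vanishes. -/
def coordKer (G : AddSubgroup (ι → UnitAddCircle)) (i : ι) : AddSubgroup G :=
  ((Pi.evalAddMonoidHom (fun _ : ι => UnitAddCircle) i).comp G.subtype).ker

lemma mem_coordKer {i : ι} {l : G} : l ∈ coordKer G i ↔ l.1 i = 0 :=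
  Iff.rfl

lemma card_sub_card_coordKer_le [Finite G] (i : ι) :
    (Nat.card G : ℝ) - Nat.card (coordKer G i) ≤ Nat.card G - 1 := by
  have : (1 : ℝ) ≤ Nat.card (coordKer G i) := by exact_mod_cast Nat.card_pos
  linarith

lemma two_mul_card_coordKer_le [Finite G] {i : ι} (hi : ∃ l ∈ G, l i ≠ 0) :
    2 * Nat.card (coordKer G i) ≤ Nat.card G := by
  obtain ⟨l, hl, hl0⟩ := hi
  have hne : (coordKer G i).index ≠ 1 := fun h => by
    rw [AddSubgroup.index_eq_one] at h
    exact hl0 (mem_coordKer (l := ⟨l, hl⟩).1 (h ▸ AddSubgroup.mem_top _))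
  have hindex : 2 ≤ (coordKer G i).index := by
    have := (coordKer G i).index_ne_zero_of_finite
    omega
  rw [← (coordKer G i).index_mul_card]
  exact Nat.mul_le_mul_right _ hindex

variable [Fintype ι]

/-- The age `∑ {λᵢ}` of an element `λ` of the torus `(ℝ/ℤ)^ι`. -/
noncomputable def age (l : ι → UnitAddCircle) : ℝ := ∑ i, circleFract (l i)

lemma age_nonneg (l : ι → UnitAddCircle) : 0 ≤ age l :=
  Finset.sum_nonneg fun _ _ => circleFract_nonneg _

lemma age_zero : age (0 : ι → UnitAddCircle) = 0 :=
  Finset.sum_eq_zero fun _ _ => circleFract_eq_zero_iff.2 rfl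

lemma age_add_age_neg (l : ι → UnitAddCircle) :
    age l + age (-l) = ∑ i, if l i = 0 then 0 else 1 := by
  simp only [age, Pi.neg_apply, ← Finset.sum_add_distrib, circleFract_add_circleFract_neg]

lemma two_mul_sum_age [Fintype G] :
    2 * ∑ l : G, age l.1 = ∑ i, ((Nat.card G : ℝ) - Nat.card (coordKer G i)) := by
  classical
  have hcount (i : ι) : ∑ l : G, (if l.1 i = 0 then (0 : ℝ) else 1) =
      Nat.card G - Nat.card (coordKer G i) := by
    have hker : Nat.card (coordKer G i) = (Finset.univ.filter fun l : G => l.1 i = 0).card :=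
      Nat.subtype_card _ fun l => by simp [mem_coordKer]
    have hsplit : ∑ l : G, (if l.1 i = 0 then (0 : ℝ) else 1) =
        ∑ l : G, (1 - if l.1 i = 0 then 1 else 0) :=
      Finset.sum_congr rfl fun l _ => by split_ifs <;> simp
    rw [hsplit, Finset.sum_sub_distrib, Finset.sum_boole, hker]
    simp
  have hneg : ∑ l : G, age (-l).1 = ∑ l : G, age l.1 :=
    Equiv.sum_comp (Equiv.neg G) fun l => age l.1
  calc 2 * ∑ l : G, age l.1
      = ∑ l : G, age l.1 + ∑ l : G, age (-l).1 := by
        rw [two_mul, hneg]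
    _ = ∑ l : G, ∑ i, if l.1 i = 0 then 0 else 1 := by
        simp only [← Finset.sum_add_distrib, NegMemClass.coe_neg, age_add_age_neg]
    _ = ∑ i, ((Nat.card G : ℝ) - Nat.card (coordKer G i)) := by
        rw [Finset.sum_comm]
        exact Finset.sum_congr rfl fun i _ => hcount i

lemma two_mul_sum_age_le [Fintype G] :
    2 * ∑ l : G, age l.1 ≤ Fintype.card ι * ((Nat.card G : ℝ) - 1) := by
  rw [two_mul_sum_age]
  refine (Finset.sum_le_card_nsmul _ _ _ fun i _ => card_sub_card_coordKer_le i).trans_eq ?_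
  rw [nsmul_eq_mul, Finset.card_univ]

lemma two_mul_sum_age_eq_iff [Fintype G] :
    2 * ∑ l : G, age l.1 = Fintype.card ι * ((Nat.card G : ℝ) - 1) ↔ ∀ i, coordKer G i = ⊥ := by
  have hconst : Fintype.card ι * ((Nat.card G : ℝ) - 1) = ∑ _i : ι, ((Nat.card G : ℝ) - 1) := by
    rw [Finset.sum_const, nsmul_eq_mul, Finset.card_univ]
  rw [two_mul_sum_age, hconst,
    Finset.sum_eq_sum_iff_of_le fun i _ => card_sub_card_coordKer_le i]
  simp [← AddSubgroup.card_eq_one]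

lemma card_mul_card_le_four_mul_sum_age [Fintype G] (hG : ∀ i, ∃ l ∈ G, l i ≠ 0) :
    (Fintype.card ι * Nat.card G : ℝ) ≤ 4 * ∑ l : G, age l.1 := by
  have hhalf (i : ι) : (Nat.card G : ℝ) / 2 ≤ Nat.card G - Nat.card (coordKer G i) := by
    have : (2 * Nat.card (coordKer G i) : ℝ) ≤ Nat.card G := by
      exact_mod_cast two_mul_card_coordKer_le (hG i)
    linarith
  have hsum := Finset.card_nsmul_le_sum Finset.univ _ _ fun i _ => hhalf i
  rw [← two_mul_sum_age, nsmul_eq_mul, Finset.card_univ] at hsum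
  linarith

end Age

section ConstInv

variable {ι : Type*}

/-- The element `(1/n, …, 1/n)` of the torus `(ℝ/ℤ)^ι`. -/
noncomputable def constInv (ι : Type*) (n : ℕ) : ι → UnitAddCircle := fun _ => (1 / (n : ℝ) : ℝ)

lemma addOrderOf_constInv [Nonempty ι] {n : ℕ} (hn : 0 < n) : addOrderOf (constInv ι n) = n :=
  (addOrderOf_injective (Pi.constAddMonoidHom ι UnitAddCircle) Function.const_injective _).trans
    (AddCircle.addOrderOf_period_div (p := (1 : ℝ)) hn)

lemma nsmul_constInv_apply (m n : ℕ) (i : ι) :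
    (m • constInv ι n) i = ((m / n : ℝ) : UnitAddCircle) := by
  rw [Pi.smul_apply, constInv, ← AddCircle.coe_nsmul, nsmul_eq_mul, mul_one_div]

lemma age_nsmul_constInv [Fintype ι] {m n : ℕ} (hmn : m < n) :
    age (m • constInv ι n) = Fintype.card ι * (m / n) := by
  have hn : (0 : ℝ) < n := by exact_mod_cast m.zero_le.trans_lt hmn
  have hfract : Int.fract (m / n : ℝ) = m / n :=
    Int.fract_eq_self.2 ⟨by positivity, (div_lt_one hn).2 (by exact_mod_cast hmn)⟩
  simp only [age, nsmul_constInv_apply, circleFract_coe, hfract, Finset.sum_const,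
    Finset.card_univ, nsmul_eq_mul]

lemma coordKer_zmultiples_constInv (n : ℕ) (i : ι) :
    coordKer (AddSubgroup.zmultiples (constInv ι n)) i = ⊥ := by
  rw [eq_bot_iff]
  rintro ⟨_, m, rfl⟩ h
  exact Subtype.ext (funext fun _ => h)

lemma eq_constInv_of_card_mul_age_eq [Fintype ι] {G : AddSubgroup (ι → UnitAddCircle)} [Finite G]
    (hker : ∀ i, coordKer G i = ⊥) {l : ι → UnitAddCircle} (hl : l ∈ G) (hl0 : l ≠ 0)
    (hage : Nat.card G * age l = Fintype.card ι) : l = constInv ι (Nat.card G) := by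
  have hge (i : ι) : 1 / (Nat.card G : ℝ) ≤ circleFract (l i) := by
    refine one_div_le_circleFract ?_ fun hli => hl0 ?_
    · have h : Nat.card G • (⟨l, hl⟩ : G) = 0 := card_nsmul_eq_zero'
      exact congrFun (congrArg Subtype.val h) i
    · have h : (⟨l, hl⟩ : G) ∈ coordKer G i := hli
      rw [hker i, AddSubgroup.mem_bot] at h
      exact congrArg Subtype.val h
  have hsum : ∑ _i : ι, 1 / (Nat.card G : ℝ) = ∑ i, circleFract (l i) := by
    have hcard : (Nat.card G : ℝ) ≠ 0 := by exact_mod_cast Nat.card_pos.ne'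
    change _ = age l
    rw [Finset.sum_const, nsmul_eq_mul, Finset.card_univ, ← hage]
    field_simp
  have heq := (Finset.sum_eq_sum_iff_of_le fun i _ => hge i).1 hsum
  funext i
  rw [constInv, heq i (Finset.mem_univ i), coe_circleFract]

lemma eq_zmultiples_constInv [Fintype ι] {G : AddSubgroup (ι → UnitAddCircle)} [Finite G]
    (hker : ∀ i, coordKer G i = ⊥) {l : ι → UnitAddCircle} (hl : l ∈ G) (hl0 : l ≠ 0)
    (hage : Nat.card G * age l = Fintype.card ι) :
    G = AddSubgroup.zmultiples (constInv ι (Nat.card G)) := by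
  have hlG := eq_constInv_of_card_mul_age_eq hker hl hl0 hage
  have : Nonempty ι := not_isEmpty_iff.1 fun _ => hl0 (Subsingleton.elim _ _)
  have hle : AddSubgroup.zmultiples (constInv ι (Nat.card G)) ≤ G := by
    rwa [AddSubgroup.zmultiples_le, ← hlG]
  refine (AddSubgroup.eq_of_le_of_card_ge hle ?_).symm
  rw [Nat.card_zmultiples, addOrderOf_constInv Nat.card_pos]

end ConstInv

section GradedCount

open PowerSeries

lemma mk_multichoose_mul_one_sub_X_pow (R : Type*) [CommRing R] (n : ℕ) :
    (mk fun m => (n.multichoose m : R)) * (1 - X) ^ n = 1 := by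
  cases n with
  | zero =>
    ext m
    cases m <;> simp
  | succ d =>
    have hchoose (m : ℕ) : (d + 1).multichoose m = (d + m).choose d := by
      rw [Nat.multichoose_eq, add_right_comm, Nat.add_sub_cancel, Nat.choose_symm_add]
    simp only [hchoose]
    exact mk_add_choose_mul_one_sub_pow_eq_one R d

variable {ι : Type*} [Fintype ι]

lemma card_sum_eq_multichoose (m : ℕ) :
    Nat.card {a : ι → ℕ // ∑ i, a i = m} = (Fintype.card ι).multichoose m := by
  classical
  rw [← Nat.card_congr (Sym.equivNatSumOfFintype ι m), Nat.card_eq_fintype_card,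
    Sym.card_sym_eq_multichoose]

lemma card_sum_add_eq_coeff (R : Type*) [CommRing R] (m n : ℕ) :
    (Nat.card {a : ι → ℕ // ∑ i, a i + m = n} : R) =
      coeff n (X ^ m * mk fun j => ((Fintype.card ι).multichoose j : R)) := by
  rw [coeff_X_pow_mul']
  split_ifs with h
  · obtain ⟨j, rfl⟩ := Nat.exists_eq_add_of_le' h
    simp only [add_left_inj, add_tsub_cancel_right, coeff_mk, card_sum_eq_multichoose]
  · have : IsEmpty {a : ι → ℕ // ∑ i, a i + m = n} := ⟨fun a => h (by omega)⟩
    simp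

instance finite_sum_add_eq (m n : ℕ) : Finite {a : ι → ℕ // ∑ i, a i + m = n} := by
  classical
  exact (Set.finite_Icc (0 : ι → ℕ) fun _ => n).subset fun a (ha : ∑ i, a i + m = n) =>
    ⟨fun _ => Nat.zero_le _, fun i => (Finset.single_le_sum (fun _ _ => Nat.zero_le _)
      (Finset.mem_univ i)).trans (Nat.le_of_add_right_le ha.le)⟩

/-- The height of a torus element, its age rounded down. It is used for elements of integral age,
where nothing is lost. -/
noncomputable def height (l : ι → UnitAddCircle) : ℕ := ⌊age l⌋₊

/-- The nonnegative real vectors of coordinate sum `t` whose class modulo `ℤ^ι` lies in `G`: the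
slice at level `t` of the monoid of lattice points of a cone with group `G`. -/
def nonnegLifts (G : AddSubgroup (ι → UnitAddCircle)) (t : ℝ) : Set (ι → ℝ) :=
  {c | (∀ i, 0 ≤ c i) ∧ ∑ i, c i = t ∧ (fun i => (c i : UnitAddCircle)) ∈ G}

variable {G : AddSubgroup (ι → UnitAddCircle)}

lemma sum_eq_sum_floor_add_age {c : ι → ℝ} (hc : ∀ i, 0 ≤ c i) :
    ∑ i, c i = ∑ i, (⌊c i⌋₊ : ℝ) + age fun i => (c i : UnitAddCircle) := by
  rw [age, ← Finset.sum_add_distrib]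
  exact Finset.sum_congr rfl fun i _ => by rw [add_comm, circleFract_coe_add_floor (hc i)]

/-- A nonnegative real vector splits into its fractional part and its integral part. -/
noncomputable def nonnegLiftsEquiv (G : AddSubgroup (ι → UnitAddCircle)) (t : ℝ) :
    nonnegLifts G t ≃ Σ l : G, {a : ι → ℕ // ∑ i, (a i : ℝ) + age l.1 = t} where
  toFun c := ⟨⟨_, c.2.2.2⟩, fun i => ⌊c.1 i⌋₊, by rw [← sum_eq_sum_floor_add_age c.2.1, c.2.2.1]⟩
  invFun x := ⟨fun i => circleFract (x.1.1 i) + x.2.1 i,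
    fun i => add_nonneg (circleFract_nonneg _) (Nat.cast_nonneg _),
    by rw [Finset.sum_add_distrib, add_comm]; exact x.2.2,
    by simpa only [coe_circleFract_add_natCast] using x.1.2⟩
  left_inv c := Subtype.ext (funext fun i => circleFract_coe_add_floor (c.2.1 i))
  right_inv x := Sigma.subtype_ext
    (Subtype.ext (funext fun _ => coe_circleFract_add_natCast _ _))
    (funext fun _ => floor_circleFract_add_natCast _ _)

lemma ncard_nonnegLifts [Fintype G] (hG : ∀ l ∈ G, (height l : ℝ) = age l)
    (R : Type*) [CommRing R] (n : ℕ) :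
    ((nonnegLifts G n).ncard : R) = coeff n ((∑ l : G, X ^ height l.1) *
      mk fun m => ((Fintype.card ι).multichoose m : R)) := by
  have hcongr (l : G) : {a : ι → ℕ // ∑ i, (a i : ℝ) + age l.1 = n} ≃
      {a : ι → ℕ // ∑ i, a i + height l.1 = n} :=
    Equiv.subtypeEquivRight fun a => by rw [← hG l.1 l.2]; exact_mod_cast Iff.rfl
  rw [← Nat.card_coe_set_eq,
    Nat.card_congr ((nonnegLiftsEquiv G n).trans (Equiv.sigmaCongrRight hcongr)), Nat.card_sigma,
    Finset.sum_mul, map_sum, Nat.cast_sum]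
  exact Finset.sum_congr rfl fun l _ => card_sum_add_eq_coeff R _ _

lemma nonnegLifts_zero : nonnegLifts G 0 = {0} := by
  ext c
  constructor
  · rintro ⟨hc, hsum, -⟩
    exact funext fun i =>
      (Finset.sum_eq_zero_iff_of_nonneg fun i _ => hc i).1 hsum i (Finset.mem_univ i)
  · rintro rfl
    exact ⟨fun _ => le_rfl, by simp, G.zero_mem⟩

end GradedCount

section AffineCombination

lemma eq_of_sum_eq_of_sum_smul_eq {k V ι : Type*} [Ring k] [AddCommGroup V] [Module k V] [Fintype ι]
    {p : ι → V} (hp : AffineIndependent k p) {c c' : ι → k} (hsum : ∑ i, c i = ∑ i, c' i)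
    (hp' : ∑ i, c i • p i = ∑ i, c' i • p i) : c = c' := by
  funext i
  refine sub_eq_zero.1 (affineIndependent_iff.1 hp Finset.univ (c - c') ?_ ?_ i (Finset.mem_univ i))
  · simp [hsum]
  · simp [sub_smul, hp']

variable {R E ι : Type*} [Field R] [LinearOrder R] [IsStrictOrderedRing R] [AddCommGroup E]
  [Module R E] [Fintype ι]

lemma convexHull_range_eq_image_stdSimplex (p : ι → E) :
    convexHull R (Set.range p) = Fintype.linearCombination R p '' stdSimplex R ι := by
  classical
  rw [← convexHull_rangle_single_eq_stdSimplex, LinearMap.image_convexHull, ← Set.range_comp]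
  congr 2
  ext i
  simp

lemma mem_smul_convexHull_range_iff [Nonempty ι] {p : ι → E} {a : R} (ha : 0 ≤ a) {x : E} :
    x ∈ a • convexHull R (Set.range p) ↔
      ∃ c : ι → R, (∀ i, 0 ≤ c i) ∧ ∑ i, c i = a ∧ ∑ i, c i • p i = x := by
  rw [convexHull_range_eq_image_stdSimplex]
  constructor
  · rintro ⟨_, ⟨c, ⟨hc, hsum⟩, rfl⟩, rfl⟩
    refine ⟨a • c, fun i => mul_nonneg ha (hc i), ?_, ?_⟩
    · simp [← Finset.mul_sum, hsum]
    · simp [Fintype.linearCombination_apply, Finset.smul_sum, mul_smul]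
  · rintro ⟨c, hc, hsum, rfl⟩
    rcases ha.eq_or_lt with rfl | ha
    · have hc0 : c = 0 := funext fun i =>
        (Finset.sum_eq_zero_iff_of_nonneg fun i _ => hc i).1 hsum i (Finset.mem_univ i)
      rw [← convexHull_range_eq_image_stdSimplex,
        Set.zero_smul_set (Set.range_nonempty p).convexHull]
      simp [hc0]
    · refine ⟨_, ⟨a⁻¹ • c, ⟨fun i => mul_nonneg (inv_nonneg.2 ha.le) (hc i), ?_⟩, rfl⟩, ?_⟩
      · simp [← Finset.mul_sum, hsum, ha.ne']
      · simp [ha.ne', Fintype.linearCombination_apply]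

end AffineCombination

section Simplex

open PowerSeries

variable {d : ℕ} {s : Affine.Simplex ℝ (Fin d → ℝ) d}

lemma exists_intVertices (hs : IsLatticeSimplex s) :
    ∃ p : Fin (d + 1) → Fin d → ℤ, ∀ i, s.points i = fun j => (p i j : ℝ) := by
  choose p hp using hs
  exact ⟨p, fun i => funext (hp i)⟩

lemma coe_mem_simplexGroup_iff (hs : IsLatticeSimplex s) (c : Fin (d + 1) → ℝ) :
    (fun i => (c i : UnitAddCircle)) ∈ simplexGroup s ↔
      (∃ y : Fin d → ℤ, ∑ i, c i • s.points i = fun j => (y j : ℝ)) ∧ ∃ z : ℤ, ∑ i, c i = z := by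
  obtain ⟨p, hp⟩ := exists_intVertices hs
  constructor
  · rintro ⟨r, hr, hrs, z, hz⟩
    choose y hy using hrs
    choose m hm using fun i => coe_unitAddCircle_eq_iff.1 (hr i)
    have hc (i : Fin (d + 1)) : c i = r i - m i := by rw [← hm, sub_sub_cancel]
    refine ⟨⟨y - ∑ i, m i • p i, funext fun j => ?_⟩, z - ∑ i, m i, by simp [hc, hz]⟩
    simp [hc, sub_mul, ← hy, hp]
  · rintro ⟨⟨y, hy⟩, hz⟩
    refine ⟨c, fun _ => rfl, fun j => ⟨y j, ?_⟩, hz⟩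
    simpa using congrFun hy j

lemma natCast_height_of_mem (hs : IsLatticeSimplex s) {l : Fin (d + 1) → UnitAddCircle}
    (hl : l ∈ simplexGroup s) : (height l : ℝ) = age l := by
  obtain ⟨z, hz⟩ : ∃ z : ℤ, age l = z := by
    refine ((coe_mem_simplexGroup_iff hs fun i => circleFract (l i)).1 ?_).2
    simpa only [coe_circleFract] using hl
  have hz0 : 0 ≤ z := by exact_mod_cast hz ▸ age_nonneg l
  lift z to ℕ using hz0
  rw [height, hz, Int.cast_natCast, Nat.floor_natCast]

-- The representatives in the unit cube map injectively to the integer points of a compact set.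
lemma finite_simplexGroup (hs : IsLatticeSimplex s) : Finite (simplexGroup s) := by
  let L (c : Fin (d + 1) → ℝ) : (Fin d → ℝ) × ℝ := (∑ i, c i • s.points i, ∑ i, c i)
  let toReal : (Fin d → ℤ) × ℤ → (Fin d → ℝ) × ℝ := fun x => (fun j => (x.1 j : ℝ), (x.2 : ℝ))
  have hL : Function.Injective L := fun c c' h =>
    eq_of_sum_eq_of_sum_smul_eq s.independent (congrArg Prod.snd h) (congrArg Prod.fst h)
  have hLcont : Continuous L := by fun_prop
  have htoReal : Topology.IsClosedEmbedding toReal :=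
    (Topology.IsClosedEmbedding.piMap fun _ => Int.isClosedEmbedding_coe_real).prodMap
      Int.isClosedEmbedding_coe_real
  have hcube : IsCompact (L '' Set.Icc 0 1) := isCompact_Icc.image hLcont
  have hfin : (toReal ⁻¹' (L '' Set.Icc 0 1)).Finite :=
    (htoReal.isCompact_preimage hcube).finite_of_discrete
  refine (((hfin.image toReal).preimage hL.injOn).image
    fun c i => (c i : UnitAddCircle)).subset fun l hl => ?_
  have hcoe : (fun i => (circleFract (l i) : UnitAddCircle)) = l :=
    funext fun i => coe_circleFract (l i)
  obtain ⟨⟨y, hy⟩, z, hz⟩ :=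
    (coe_mem_simplexGroup_iff hs fun i => circleFract (l i)).1 (hcoe.symm ▸ hl)
  have hyz : toReal (y, z) = L fun i => circleFract (l i) := Prod.ext hy.symm hz.symm
  refine ⟨_, ⟨(y, z), ⟨_, ?_, hyz.symm⟩, hyz⟩, hcoe⟩
  exact ⟨fun i => circleFract_nonneg _, fun i => (circleFract_lt_one _).le⟩

lemma latticePointCount_simplexHull (hs : IsLatticeSimplex s) (n : ℕ) :
    latticePointCount (simplexHull s) n = (nonnegLifts (simplexGroup s) n).ncard := by
  have htoReal : Function.Injective fun (z : Fin d → ℤ) j => (z j : ℝ) := fun z z' h =>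
    funext fun j => Int.cast_injective (congrFun h j)
  have hcomb : Set.InjOn (fun c : Fin (d + 1) → ℝ => ∑ i, c i • s.points i)
      (nonnegLifts (simplexGroup s) n) := fun c hc c' hc' h =>
    eq_of_sum_eq_of_sum_smul_eq s.independent (hc.2.1.trans hc'.2.1.symm) h
  rw [latticePointCount, ← Set.ncard_image_of_injective _ htoReal, ← hcomb.ncard_image]
  congr 1
  ext x
  constructor
  · rintro ⟨z, hz, rfl⟩
    obtain ⟨c, hc, hsum, hcz⟩ := (mem_smul_convexHull_range_iff n.cast_nonneg).1 hz
    exact ⟨c, ⟨hc, hsum, (coe_mem_simplexGroup_iff hs c).2 ⟨⟨z, hcz⟩, n, by simp [hsum]⟩⟩, hcz⟩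
  · rintro ⟨c, ⟨hc, hsum, hmem⟩, rfl⟩
    obtain ⟨⟨z, hcz⟩, -⟩ := (coe_mem_simplexGroup_iff hs c).1 hmem
    exact ⟨z, (mem_smul_convexHull_range_iff n.cast_nonneg).2 ⟨c, hc, hsum, hcz⟩, hcz.symm⟩

lemma ehrhartSeries_simplexHull (hs : IsLatticeSimplex s) [Fintype (simplexGroup s)] :
    ehrhartSeries (simplexHull s) = (∑ l : simplexGroup s, X ^ height l.1) *
      PowerSeries.mk fun m => ((d + 1).multichoose m : ℤ) := by
  have hcoeff (n : ℕ) := ncard_nonnegLifts (fun l => natCast_height_of_mem hs (l := l)) ℤ n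
  simp only [Fintype.card_fin] at hcoeff
  ext n
  rw [← hcoeff, ehrhartSeries, PowerSeries.coeff_mk, latticePointCount_simplexHull hs]
  split_ifs with hn
  · rw [hn, Nat.cast_zero, nonnegLifts_zero, Set.ncard_singleton, Nat.cast_one]
  · rfl

theorem deltaSeries_simplexHull (hs : IsLatticeSimplex s) [Fintype (simplexGroup s)] :
    deltaSeries (simplexHull s) = ∑ l : simplexGroup s, X ^ height l.1 := by
  rw [deltaSeries, ehrhartSeries_simplexHull hs, mul_comm, mul_assoc,
    mk_multichoose_mul_one_sub_X_pow, mul_one]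

end Simplex

section Pyramid

open Matrix

lemma exists_vecMul_eq {n R : Type*} [Fintype n] [DecidableEq n] [CommRing R]
    (g : (n → R) ≃ₗ[R] (n → R)) : ∃ U : Matrix n n R, IsUnit U.det ∧ ∀ x, x ᵥ* U = g x := by
  refine ⟨(LinearMap.toMatrix' (g : (n → R) →ₗ[R] n → R))ᵀ, ?_, fun x => ?_⟩
  · rw [det_transpose, LinearMap.det_toMatrix']
    exact g.isUnit_det'
  · rw [vecMul_transpose, LinearMap.toMatrix'_mulVec, LinearEquiv.coe_coe]

-- `u` complements the kernel of `f`, so a basis of the kernel extends by `u` to a basis.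
lemma exists_linearEquiv_last_eq {R : Type*} [CommRing R] [IsDomain R] [IsPrincipalIdealRing R]
    {e : ℕ} (f : (Fin (e + 1) → R) →ₗ[R] R) {u : Fin (e + 1) → R} (hu : f u = 1) :
    ∃ g : (Fin (e + 1) → R) ≃ₗ[R] (Fin (e + 1) → R),
      (∀ x, g x (Fin.last e) = f x) ∧ g u = Pi.single (Fin.last e) 1 := by
  have hsurj : Function.Surjective f := fun a => ⟨a • u, by simp [hu]⟩
  have hrank : Module.finrank R (LinearMap.ker f) = e := by
    have h := Submodule.finrank_quotient_add_finrank (LinearMap.ker f)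
    rw [(f.quotKerEquivOfSurjective hsurj).finrank_eq, Module.finrank_self,
      Module.finrank_fin_fun] at h
    omega
  let b := Module.finBasisOfFinrankEq R (LinearMap.ker f) hrank
  let B := Module.Basis.mkFinSnoc b u
    (fun c x hx h => by simpa [hu, LinearMap.mem_ker.1 hx] using congrArg f h)
    fun z => ⟨-f z, by simp [LinearMap.mem_ker, hu]⟩
  have hB : ⇑B = Fin.snoc (Subtype.val ∘ b) u := Module.Basis.coe_mkFinSnoc _ _ _ _
  have hBlast : B (Fin.last e) = u := by rw [hB, Fin.snoc_last]
  have hBu : B.equivFun u = Pi.single (Fin.last e) 1 := by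
    rw [← hBlast, B.equivFun_apply, B.repr_self, Finsupp.single_eq_pi_single]
  have hlast : B.coord (Fin.last e) = f := B.ext fun i => by
    refine Fin.lastCases ?_ (fun i => ?_) i
    · rw [hBlast, hu, ← hBlast]
      simp
    · have hfi : f (B i.castSucc) = 0 := by
        rw [hB, Fin.snoc_castSucc]
        exact (b i).2
      rw [hfi]
      simp
  exact ⟨B.equivFun, fun x => LinearMap.congr_fun hlast x, hBu⟩

lemma exists_intLinearMap_eq {ι : Type*} (φ : (ι → ℝ) →ₗ[ℝ] ℝ)
    (hφ : ∀ z : ι → ℤ, ∃ a : ℤ, φ (fun j => (z j : ℝ)) = a) :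
    ∃ f : (ι → ℤ) →ₗ[ℤ] ℤ, ∀ z : ι → ℤ, φ (fun j => (z j : ℝ)) = f z := by
  choose F hF using hφ
  refine ⟨(AddMonoidHom.mk' F fun x y => ?_).toIntLinearMap, hF⟩
  have hcast : (fun j => ((x + y) j : ℝ)) = (fun j => (x j : ℝ)) + fun j => (y j : ℝ) := by
    ext j
    simp
  have hadd := hF (x + y)
  rw [hcast, map_add, hF, hF] at hadd
  exact_mod_cast hadd.symm

section Barycentric

variable {d : ℕ} {s : Affine.Simplex ℝ (Fin d → ℝ) d}

/-- The vertices of a full-dimensional simplex, as an affine basis. Its coordinates are the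
barycentric coordinates. -/
noncomputable def vertexBasis (s : Affine.Simplex ℝ (Fin d → ℝ) d) :
    AffineBasis (Fin (d + 1)) ℝ (Fin d → ℝ) :=
  ⟨s.points, s.independent,
    s.independent.affineSpan_eq_top_iff_card_eq_finrank_add_one.2 (by simp)⟩

lemma vertexBasis_coord_points (i m : Fin (d + 1)) :
    (vertexBasis s).coord i (s.points m) = if i = m then 1 else 0 :=
  (vertexBasis s).coord_apply i m

lemma exists_int_vertexBasis_coord_eq (hs : IsLatticeSimplex s) {i : Fin (d + 1)}
    (hi : ∀ l ∈ simplexGroup s, l i = 0) (z : Fin d → ℤ) :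
    ∃ a : ℤ, (vertexBasis s).coord i (fun j => z j) = a := by
  have hmem : (fun i => ((vertexBasis s).coord i (fun j => (z j : ℝ)) : UnitAddCircle)) ∈
      simplexGroup s :=
    (coe_mem_simplexGroup_iff hs _).2
      ⟨⟨z, (vertexBasis s).linear_combination_coord_eq_self fun j => (z j : ℝ)⟩, 1,
        by simpa only [Int.cast_one] using
          (vertexBasis s).sum_coord_apply_eq_one fun j => (z j : ℝ)⟩
  obtain ⟨a, ha⟩ := (AddCircle.coe_eq_zero_iff (1 : ℝ)).1 (hi _ hmem)
  exact ⟨a, by simpa using ha.symm⟩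

lemma exists_intLinearMap_vertex_sub_eq (hs : IsLatticeSimplex s) {p : Fin (d + 1) → Fin d → ℤ}
    (hp : ∀ m, s.points m = fun n => (p m n : ℝ)) {i j : Fin (d + 1)}
    (hi : ∀ l ∈ simplexGroup s, l i = 0) (hij : i ≠ j) :
    ∃ f : (Fin d → ℤ) →ₗ[ℤ] ℤ, ∀ m, f (p m - p j) = if i = m then 1 else 0 := by
  have hcoord (z : Fin d → ℤ) : ((vertexBasis s).coord i).linear (fun n => (z n : ℝ)) =
      (vertexBasis s).coord i (fun n => ((z + p j) n : ℝ)) := by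
    have hvadd := ((vertexBasis s).coord i).map_vadd (s.points j) fun n => (z n : ℝ)
    rw [vertexBasis_coord_points, if_neg hij, vadd_eq_add, vadd_eq_add, add_zero, hp] at hvadd
    rw [← hvadd]
    congr 1
    ext n
    simp
  obtain ⟨f, hf⟩ := exists_intLinearMap_eq ((vertexBasis s).coord i).linear fun z => by
    rw [hcoord]
    exact exists_int_vertexBasis_coord_eq hs hi _
  refine ⟨f, fun m => ?_⟩
  have hfm := hcoord (p m - p j)
  rw [hf, sub_add_cancel, ← hp, vertexBasis_coord_points] at hfm
  exact_mod_cast hfm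

end Barycentric

/-- The real affine map `x ↦ x U + w` of an integer matrix `U` and an integer vector `w`, as it
occurs in `UnimodularlyEquivalent`. -/
noncomputable def unimodularMap {d : ℕ} (U : Matrix (Fin d) (Fin d) ℤ) (w : Fin d → ℤ) :
    (Fin d → ℝ) →ᵃ[ℝ] (Fin d → ℝ) :=
  (vecMulLinear (U.map fun a => (a : ℝ))).toAffineMap + AffineMap.const ℝ _ fun j => (w j : ℝ)

lemma unimodularMap_apply {d : ℕ} (U : Matrix (Fin d) (Fin d) ℤ) (w : Fin d → ℤ) (x : Fin d → ℝ) :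
    unimodularMap U w x = x ᵥ* U.map (fun a => (a : ℝ)) + fun j => (w j : ℝ) :=
  rfl

lemma unimodularMap_intCast {d : ℕ} (U : Matrix (Fin d) (Fin d) ℤ) (w z : Fin d → ℤ) :
    unimodularMap U w (fun j => (z j : ℝ)) = fun j => ((z ᵥ* U + w) j : ℝ) := by
  ext j
  simp [unimodularMap_apply, vecMul, dotProduct]

lemma unimodularMap_injective {d : ℕ} {U : Matrix (Fin d) (Fin d) ℤ} (hU : IsUnit U.det)
    (w : Fin d → ℤ) : Function.Injective (unimodularMap U w) := by
  have hUR : IsUnit (U.map fun a => (a : ℝ)) :=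
    ((isUnit_iff_isUnit_det U).2 hU).map (Int.castRingHom ℝ).mapMatrix
  intro x y h
  simp only [unimodularMap_apply, add_left_inj] at h
  exact vecMul_injective_of_isUnit hUR h

/-- The inclusion of `ℝ^e` in `ℝ^{e+1}` as the hyperplane with last coordinate `0`, which contains
the base of `latticePyramid`. -/
noncomputable def snocZero (e : ℕ) : (Fin e → ℝ) →ₗ[ℝ] (Fin (e + 1) → ℝ) where
  toFun x := Fin.snoc (α := fun _ => ℝ) x 0
  map_add' x y := by
    ext i
    refine Fin.lastCases ?_ (fun i => ?_) i <;> simp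
  map_smul' a x := by
    ext i
    refine Fin.lastCases ?_ (fun i => ?_) i <;> simp

variable {e : ℕ}

lemma latticePyramid_simplexHull (s : Affine.Simplex ℝ (Fin e → ℝ) e) :
    latticePyramid (simplexHull s) = convexHull ℝ
      (insert (Fin.snoc (α := fun _ => ℝ) 0 1) (Set.range (snocZero e ∘ s.points))) := by
  have hbase : (fun x => Fin.snoc (α := fun _ => ℝ) x 0) '' simplexHull s =
      convexHull ℝ (Set.range (snocZero e ∘ s.points)) := by
    rw [Set.range_comp]
    exact (snocZero e).image_convexHull _
  rw [latticePyramid, hbase, convexHull_convexHull_union_left, Set.union_singleton]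

lemma isLatticePyramid_of_vecMul {s : Affine.Simplex ℝ (Fin (e + 1) → ℝ) (e + 1)}
    {p : Fin (e + 2) → Fin (e + 1) → ℤ} (hp : ∀ m, s.points m = fun n => (p m n : ℝ))
    {U : Matrix (Fin (e + 1)) (Fin (e + 1)) ℤ} (hU : IsUnit U.det) {w : Fin (e + 1) → ℤ}
    {i : Fin (e + 2)} (happex : p i ᵥ* U + w = Pi.single (Fin.last e) 1)
    (hbase : ∀ m ≠ i, (p m ᵥ* U + w) (Fin.last e) = 0) : IsLatticePyramid (simplexHull s) := by
  let q (m : Fin (e + 1)) (n : Fin e) : ℤ := (p (i.succAbove m) ᵥ* U + w) n.castSucc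
  have hmap (m) : unimodularMap U w (s.points m) = fun n => ((p m ᵥ* U + w) n : ℝ) := by
    rw [hp, unimodularMap_intCast]
  have hmapi : unimodularMap U w (s.points i) = Fin.snoc (α := fun _ => ℝ) 0 1 := by
    rw [hmap, happex]
    ext n
    refine Fin.lastCases ?_ (fun n => ?_) n <;> simp
  have hmapq : unimodularMap U w ∘ s.points ∘ i.succAbove =
      snocZero e ∘ fun m n => (q m n : ℝ) := by
    ext m n
    rw [Function.comp_apply, Function.comp_apply, hmap]
    refine Fin.lastCases ?_ (fun n => ?_) n
    · simp [snocZero, hbase _ (i.succAbove_ne m)]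
    · simp [snocZero, q]
  have hq : AffineIndependent ℝ fun m n => (q m n : ℝ) := by
    refine AffineIndependent.of_comp (snocZero e).toAffineMap ?_
    rw [LinearMap.coe_toAffineMap, ← hmapq]
    exact (s.independent.comp_embedding i.succAboveEmb).map' _ (unimodularMap_injective hU w)
  refine ⟨⟨_, hq⟩, fun m n => ⟨q m n, rfl⟩, U, w, Int.isUnit_iff.1 hU, ?_⟩
  rw [latticePyramid_simplexHull]
  refine Eq.trans ?_ ((unimodularMap U w).image_convexHull (Set.range s.points)).symm
  rw [← Set.range_comp, ← hmapq, ← hmapi]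
  congr 1
  ext x
  simp [Fin.exists_iff_succAbove (p := i), eq_comm]

theorem isLatticePyramid_of_forall_apply_eq_zero {d : ℕ} (hd : 1 ≤ d)
    {s : Affine.Simplex ℝ (Fin d → ℝ) d} (hs : IsLatticeSimplex s) {i : Fin (d + 1)}
    (hi : ∀ l ∈ simplexGroup s, l i = 0) : IsLatticePyramid (simplexHull s) := by
  obtain ⟨e, rfl⟩ := Nat.exists_eq_add_of_le' hd
  obtain ⟨j, hji⟩ := exists_ne i
  obtain ⟨p, hp⟩ := exists_intVertices hs
  obtain ⟨f, hf⟩ := exists_intLinearMap_vertex_sub_eq hs hp hi hji.symm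
  obtain ⟨g, hglast, hg⟩ := exists_linearEquiv_last_eq f ((hf i).trans (if_pos rfl))
  obtain ⟨U, hU, hUg⟩ := exists_vecMul_eq g
  have hmap (m : Fin (e + 2)) : p m ᵥ* U + -(p j ᵥ* U) = g (p m - p j) := by
    rw [← hUg, sub_vecMul, sub_eq_add_neg]
  refine isLatticePyramid_of_vecMul hp hU ((hmap i).trans hg) fun m hm => ?_
  rw [hmap, hglast, hf, if_neg hm.symm]

end Pyramid

section Cyclic

lemma sum_eq_sum_range_addOrderOf {A M : Type*} [AddGroup A] [AddCommMonoid M] {G : AddSubgroup A}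
    [Fintype G] {x : A} (hG : G = AddSubgroup.zmultiples x) (f : A → M) :
    ∑ a : G, f a = ∑ i ∈ Finset.range (addOrderOf x), f (i • x) := by
  subst hG
  have hx : IsOfFinAddOrder x := finite_zmultiples.1 (Set.toFinite _)
  rw [← Fin.sum_univ_eq_sum_range fun i => f (i • x)]
  exact (Equiv.sum_comp (finEquivZMultiples hx) fun a => f a).symm

lemma height_nsmul_constInv {ι : Type*} [Fintype ι] {m n k : ℕ} (hι : Fintype.card ι = n * k)
    (hmn : m < n) : height (m • constInv ι n) = m * k := by
  have hn : (n : ℝ) ≠ 0 := by exact_mod_cast (m.zero_le.trans_lt hmn).ne'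
  have hage : (Fintype.card ι : ℝ) * (m / n) = (m * k : ℕ) := by
    rw [hι]
    push_cast
    field_simp
  rw [height, age_nsmul_constInv hmn, hage, Nat.floor_natCast]

variable {d v k : ℕ}

lemma deltaSeries_of_simplexGroup_eq_zmultiples {s : Affine.Simplex ℝ (Fin d → ℝ) d}
    (hs : IsLatticeSimplex s) (hv : 0 < v) (hd : d + 1 = v * (k + 1))
    (hG : simplexGroup s = AddSubgroup.zmultiples (constInv (Fin (d + 1)) v)) :
    deltaSeries (simplexHull s) = ∑ i ∈ Finset.range v, PowerSeries.X ^ (i * (k + 1)) := by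
  have := finite_simplexGroup hs
  have := Fintype.ofFinite (simplexGroup s)
  rw [deltaSeries_simplexHull hs,
    sum_eq_sum_range_addOrderOf hG fun l => (PowerSeries.X : PowerSeries ℤ) ^ height l,
    addOrderOf_constInv hv]
  refine Finset.sum_congr rfl fun i hi => ?_
  rw [height_nsmul_constInv ((Fintype.card_fin _).trans hd) (Finset.mem_range.1 hi)]

variable {a : Fin d → ℤ}

/-- The points `v a - (1, …, 1), e₁, …, e_d`. Their sum is `v a`, so that `(1/v, …, 1/v)` lies in
the group of a simplex with these vertices. -/
def cyclicVertices (v : ℕ) (a : Fin d → ℤ) : Fin (d + 1) → Fin d → ℝ :=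
  Fin.cons (fun j => v * a j - 1) fun i => Pi.single i 1

lemma sum_mul_cyclicVertices (c : Fin (d + 1) → ℝ) (j : Fin d) :
    ∑ i, c i * cyclicVertices v a i j = c 0 * (v * a j - 1) + c j.succ := by
  simp [Fin.sum_univ_succ, cyclicVertices, Pi.single_apply]

lemma sum_eq_sum_mul_cyclicVertices_add (hd : d + 1 = v * (k + 1)) (ha : ∑ j, a j = k)
    (c : Fin (d + 1) → ℝ) :
    ∑ i, c i = ∑ j, ∑ i, c i * cyclicVertices v a i j + v * c 0 := by
  have ha' : ∑ j, (a j : ℝ) = k := by exact_mod_cast ha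
  have hd' : (d : ℝ) + 1 = v * (k + 1) := by exact_mod_cast hd
  simp only [sum_mul_cyclicVertices, Finset.sum_add_distrib, ← Finset.mul_sum,
    Finset.sum_sub_distrib, ha', Finset.sum_const, Finset.card_univ, Fintype.card_fin, nsmul_eq_mul]
  rw [Fin.sum_univ_succ]
  linear_combination c 0 * hd'

lemma affineIndependent_cyclicVertices (hv : 0 < v) (hd : d + 1 = v * (k + 1))
    (ha : ∑ j, a j = k) : AffineIndependent ℝ (cyclicVertices v a) := by
  rw [affineIndependent_iff_of_fintype]
  intro c hc hc'
  rw [Finset.univ.weightedVSub_eq_linear_combination hc] at hc'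
  have hcoord (j : Fin d) : ∑ i, c i * cyclicVertices v a i j = 0 := by
    simpa using congrFun hc' j
  have hc0 : c 0 = 0 := by
    simpa [hc, hcoord, hv.ne'] using sum_eq_sum_mul_cyclicVertices_add hd ha c
  refine Fin.cases hc0 fun j => ?_
  simpa [sum_mul_cyclicVertices, hc0] using hcoord j

lemma exists_int_cyclicVertices_eq (v : ℕ) (a : Fin d → ℤ) (i : Fin (d + 1)) (j : Fin d) :
    ∃ z : ℤ, cyclicVertices v a i j = z := by
  refine Fin.cases ⟨v * a j - 1, by simp [cyclicVertices]⟩ (fun i => ?_) i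
  exact ⟨if j = i then 1 else 0, by simp [cyclicVertices, Pi.single_apply]⟩

lemma simplexGroup_eq_zmultiples_of_points_eq (hv : 0 < v) (hd : d + 1 = v * (k + 1))
    (ha : ∑ j, a j = k) {s : Affine.Simplex ℝ (Fin d → ℝ) d} (hs : s.points = cyclicVertices v a) :
    simplexGroup s = AddSubgroup.zmultiples (constInv (Fin (d + 1)) v) := by
  have hv0 : (v : ℝ) ≠ 0 := by exact_mod_cast hv.ne'
  refine le_antisymm ?_ ?_
  · rintro l ⟨c, hcl, hcoord, z, hz⟩
    choose y hy using hcoord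
    rw [hs] at hy
    obtain ⟨n, hn⟩ : ∃ n : ℤ, v * c 0 = n := by
      refine ⟨z - ∑ j, y j, ?_⟩
      push_cast
      rw [← hz, sum_eq_sum_mul_cyclicVertices_add hd ha c]
      simp only [hy, add_sub_cancel_left]
    have hc (i : Fin (d + 1)) : ∃ m : ℤ, n * (1 / v) - c i = m := by
      rw [← hn, mul_one_div, mul_div_cancel_left₀ _ hv0]
      refine Fin.cases ⟨0, by simp⟩ (fun j => ⟨n * a j - y j, ?_⟩) i
      push_cast
      rw [← hy, sum_mul_cyclicVertices, ← hn]
      ring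
    refine ⟨n, funext fun i => ?_⟩
    change (n • constInv (Fin (d + 1)) v) i = l i
    rw [← hcl, Pi.smul_apply, constInv, ← AddCircle.coe_zsmul, zsmul_eq_mul,
      coe_unitAddCircle_eq_iff]
    exact hc i
  · rw [AddSubgroup.zmultiples_le]
    refine ⟨fun _ => 1 / v, fun _ => rfl, fun j => ⟨a j, ?_⟩, k + 1, ?_⟩
    · rw [hs, sum_mul_cyclicVertices]
      field_simp
      ring
    · rw [Finset.sum_const, Finset.card_univ, Fintype.card_fin, hd, nsmul_eq_mul]
      push_cast
      field_simp

theorem exists_isLatticeSimplex_deltaSeries_eq (hv : 0 < v) (k : ℕ) :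
    ∃ (d : ℕ) (s : Affine.Simplex ℝ (Fin d → ℝ) d), IsLatticeSimplex s ∧
      deltaSeries (simplexHull s) = ∑ i ∈ Finset.range v, PowerSeries.X ^ (i * (k + 1)) := by
  obtain ⟨d, hd⟩ : ∃ d, d + 1 = v * (k + 1) := Nat.exists_add_one_eq.2 (by positivity)
  obtain ⟨a, ha⟩ : ∃ a : Fin d → ℤ, ∑ j, a j = k := by
    rcases d with _ | e
    · have hk : k + 1 = 1 := Nat.eq_one_of_mul_eq_one_left hd.symm
      exact ⟨0, by simp; omega⟩
    · exact ⟨Pi.single 0 k, by simp⟩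
  let s : Affine.Simplex ℝ (Fin d → ℝ) d := ⟨_, affineIndependent_cyclicVertices hv hd ha⟩
  have hs : IsLatticeSimplex s := exists_int_cyclicVertices_eq v a
  exact ⟨d, s, hs, deltaSeries_of_simplexGroup_eq_zmultiples hs hv hd
    (simplexGroup_eq_zmultiples_of_points_eq hv hd ha rfl)⟩

end Cyclic

section Dimension

open PowerSeries

lemma map_val_eq_of_sum_X_pow_eq {R α β : Type*} [Semiring R] [CharZero R] {s : Finset α}
    {t : Finset β} {f : α → ℕ} {g : β → ℕ}
    (h : ∑ a ∈ s, (X : R⟦X⟧) ^ f a = ∑ b ∈ t, X ^ g b) : s.val.map f = t.val.map g := by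
  ext n
  have hn := congrArg (coeff n) h
  simp only [map_sum, coeff_X_pow, Finset.sum_boole, Nat.cast_inj] at hn
  rw [Multiset.count_map, Multiset.count_map]
  exact hn

variable {d v k : ℕ} {s : Affine.Simplex ℝ (Fin d → ℝ) d}

lemma map_height_simplexGroup_eq (hs : IsLatticeSimplex s) [Fintype (simplexGroup s)]
    (hδ : deltaSeries (simplexHull s) = ∑ i ∈ Finset.range v, X ^ (i * (k + 1))) :
    Finset.univ.val.map (fun l : simplexGroup s => height l.1) =
      (Finset.range v).val.map fun i => i * (k + 1) :=
  map_val_eq_of_sum_X_pow_eq ((deltaSeries_simplexHull hs).symm.trans hδ)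

lemma card_simplexGroup_eq (hs : IsLatticeSimplex s)
    (hδ : deltaSeries (simplexHull s) = ∑ i ∈ Finset.range v, X ^ (i * (k + 1))) :
    Nat.card (simplexGroup s) = v := by
  have := finite_simplexGroup hs
  have := Fintype.ofFinite (simplexGroup s)
  have hcard := congrArg Multiset.card (map_height_simplexGroup_eq hs hδ)
  rwa [Multiset.card_map, Multiset.card_map, Finset.card_val, Finset.card_val, Finset.card_univ,
    Finset.card_range, ← Nat.card_eq_fintype_card] at hcard

lemma two_mul_sum_age_simplexGroup_eq (hs : IsLatticeSimplex s) [Fintype (simplexGroup s)]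
    (hδ : deltaSeries (simplexHull s) = ∑ i ∈ Finset.range v, X ^ (i * (k + 1))) :
    2 * ∑ l : simplexGroup s, age l.1 = v * ((v - 1) * (k + 1)) := by
  have hsum : ∑ l : simplexGroup s, height l.1 = ∑ i ∈ Finset.range v, i * (k + 1) :=
    congrArg Multiset.sum (map_height_simplexGroup_eq hs hδ)
  have hage : ∑ l : simplexGroup s, age l.1 = (∑ l : simplexGroup s, height l.1 : ℕ) := by
    rw [Nat.cast_sum]
    exact Finset.sum_congr rfl fun l _ => (natCast_height_of_mem hs l.2).symm
  have hgauss : (∑ i ∈ Finset.range v, (i : ℝ)) * 2 = v * (v - 1) := by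
    rcases v.eq_zero_or_pos with rfl | hv
    · simp
    · rw [← Nat.cast_pred hv, ← Nat.cast_sum]
      exact_mod_cast Finset.sum_range_id_mul_two v
  rw [hage, hsum, ← Finset.sum_mul]
  push_cast
  linear_combination ((k : ℝ) + 1) * hgauss

lemma exists_mem_simplexGroup_age_eq (hs : IsLatticeSimplex s) (hv : 1 < v)
    (hδ : deltaSeries (simplexHull s) = ∑ i ∈ Finset.range v, X ^ (i * (k + 1))) :
    ∃ l ∈ simplexGroup s, age l = k + 1 := by
  have := finite_simplexGroup hs
  have := Fintype.ofFinite (simplexGroup s)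
  have hmem : 1 * (k + 1) ∈ (Finset.range v).val.map fun i => i * (k + 1) :=
    Multiset.mem_map_of_mem _ (Finset.mem_range.2 hv)
  rw [← map_height_simplexGroup_eq hs hδ, Multiset.mem_map] at hmem
  obtain ⟨l, -, hl⟩ := hmem
  exact ⟨l, l.2, by rw [← natCast_height_of_mem hs l.2, hl]; push_cast; ring⟩

lemma le_dim_add_one_of_deltaSeries_eq (hs : IsLatticeSimplex s) (hv : 1 < v)
    (hδ : deltaSeries (simplexHull s) = ∑ i ∈ Finset.range v, X ^ (i * (k + 1))) :
    v * (k + 1) ≤ d + 1 := by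
  have := finite_simplexGroup hs
  have := Fintype.ofFinite (simplexGroup s)
  have hle := two_mul_sum_age_le (G := simplexGroup s)
  rw [two_mul_sum_age_simplexGroup_eq hs hδ, card_simplexGroup_eq hs hδ, Fintype.card_fin,
    mul_left_comm, mul_comm ((d + 1 : ℕ) : ℝ)] at hle
  have hv' : (0 : ℝ) < v - 1 := sub_pos.2 (by exact_mod_cast hv)
  exact_mod_cast le_of_mul_le_mul_left hle hv'

lemma dim_add_one_le_of_deltaSeries_eq (hs : IsLatticeSimplex s)
    (hne : ∀ i, ∃ l ∈ simplexGroup s, l i ≠ 0)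
    (hδ : deltaSeries (simplexHull s) = ∑ i ∈ Finset.range v, X ^ (i * (k + 1))) :
    (d : ℤ) + 1 ≤ 2 * ((v - 1) * (k + 1)) := by
  have := finite_simplexGroup hs
  have := Fintype.ofFinite (simplexGroup s)
  have hv : (0 : ℝ) < v := by
    rw [← card_simplexGroup_eq hs hδ]
    exact_mod_cast Nat.card_pos
  have hsum := two_mul_sum_age_simplexGroup_eq hs hδ
  have hle := card_mul_card_le_four_mul_sum_age hne
  rw [card_simplexGroup_eq hs hδ, Fintype.card_fin] at hle
  have hmul : (v : ℝ) * ((d + 1 : ℕ) : ℝ) ≤ v * (2 * ((v - 1) * (k + 1))) := by linarith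
  exact_mod_cast le_of_mul_le_mul_left hmul hv

lemma dim_add_one_eq_iff_simplexGroup_eq_zmultiples (hs : IsLatticeSimplex s) (hv : 1 < v)
    (hδ : deltaSeries (simplexHull s) = ∑ i ∈ Finset.range v, X ^ (i * (k + 1))) :
    d + 1 = v * (k + 1) ↔
      simplexGroup s = AddSubgroup.zmultiples (constInv (Fin (d + 1)) v) := by
  have := finite_simplexGroup hs
  have := Fintype.ofFinite (simplexGroup s)
  have hcard := card_simplexGroup_eq hs hδ
  have hker : d + 1 = v * (k + 1) ↔ ∀ i, coordKer (simplexGroup s) i = ⊥ := by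
    have hv' : (v : ℝ) - 1 ≠ 0 := (sub_pos.2 (by exact_mod_cast hv)).ne'
    rw [← two_mul_sum_age_eq_iff, two_mul_sum_age_simplexGroup_eq hs hδ, hcard, Fintype.card_fin,
      mul_left_comm, mul_comm ((d + 1 : ℕ) : ℝ), mul_right_inj' hv', eq_comm]
    exact_mod_cast Iff.rfl
  constructor
  · intro hd
    obtain ⟨l, hl, hage⟩ := exists_mem_simplexGroup_age_eq hs hv hδ
    have hl0 : l ≠ 0 := by
      rintro rfl
      rw [age_zero] at hage
      exact k.cast_add_one_ne_zero hage.symm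
    have hcardage : Nat.card (simplexGroup s) * age l = Fintype.card (Fin (d + 1)) := by
      rw [hcard, hage, Fintype.card_fin, hd]
      push_cast
      ring
    rw [eq_zmultiples_constInv (hker.1 hd) hl hl0 hcardage, hcard]
  · intro hG
    rw [hker, hG]
    exact coordKer_zmultiples_constInv v

end Dimension

theorem theorem2p1_general (v k : ℕ) (hv : 0 < v) :
    (∃ (d : ℕ) (s : Affine.Simplex ℝ (Fin d → ℝ) d), IsLatticeSimplex s ∧
      deltaSeries (simplexHull s) =
        ∑ i ∈ Finset.range v, (PowerSeries.X : PowerSeries ℤ) ^ (i * (k + 1))) ∧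
    ∀ (d : ℕ) (s : Affine.Simplex ℝ (Fin d → ℝ) d), 1 ≤ d → IsLatticeSimplex s →
      deltaSeries (simplexHull s) =
        ∑ i ∈ Finset.range v, (PowerSeries.X : PowerSeries ℤ) ^ (i * (k + 1)) →
      ¬ IsLatticePyramid (simplexHull s) →
      ((v : ℤ) * ((k : ℤ) + 1) - 1 ≤ (d : ℤ) ∧
        (d : ℤ) ≤ 2 * ((v : ℤ) - 1) * ((k : ℤ) + 1) - 1) ∧
      ((d : ℤ) = (v : ℤ) * ((k : ℤ) + 1) - 1 ↔
        simplexGroup s =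
          AddSubgroup.zmultiples
            (fun _ : Fin (d + 1) => ((1 / (v : ℝ) : ℝ) : UnitAddCircle))) := by
  refine ⟨exists_isLatticeSimplex_deltaSeries_eq hv k, fun d s hd hs hδ hpyr => ?_⟩
  have hne (i : Fin (d + 1)) : ∃ l ∈ simplexGroup s, l i ≠ 0 := by
    by_contra! hzero
    exact hpyr (isLatticePyramid_of_forall_apply_eq_zero hd hs hzero)
  have hupper := dim_add_one_le_of_deltaSeries_eq hs hne hδ
  have hv1 : 1 < v := by
    have : (0 : ℤ) < (v - 1) * (k + 1) := by omega
    have : (0 : ℤ) < v - 1 := pos_of_mul_pos_left this (by positivity)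
    omega
  have hlower : (v : ℤ) * (k + 1) ≤ d + 1 := by
    exact_mod_cast le_dim_add_one_of_deltaSeries_eq hs hv1 hδ
  refine ⟨⟨by linarith, by linarith⟩, ?_⟩
  rw [eq_sub_iff_add_eq]
  exact_mod_cast dim_add_one_eq_iff_simplexGroup_eq_zmultiples hs hv1 hδ

theorem theorem2p1 (v k : ℕ) (hv : 0 < v) :
    (∃ (d : ℕ) (s : Affine.Simplex ℝ (Fin d → ℝ) d), IsLatticeSimplex s ∧
      deltaSeries (simplexHull s) =
        ∑ i ∈ Finset.range v, (PowerSeries.X : PowerSeries ℤ) ^ (i * (k + 1))) ∧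
    ∀ (d : ℕ) (s : Affine.Simplex ℝ (Fin d → ℝ) d), 1 ≤ d → IsLatticeSimplex s →
      deltaSeries (simplexHull s) =
        ∑ i ∈ Finset.range v, (PowerSeries.X : PowerSeries ℤ) ^ (i * (k + 1)) →
      ¬ IsLatticePyramid (simplexHull s) →
      ((v : ℤ) * ((k : ℤ) + 1) - 1 ≤ (d : ℤ) ∧
        (d : ℤ) ≤ 4 * ((v : ℤ) - 1) * ((k : ℤ) + 1) - 2) ∧
      ((d : ℤ) = (v : ℤ) * ((k : ℤ) + 1) - 1 ↔
        simplexGroup s =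
          AddSubgroup.zmultiples
            (fun _ : Fin (d + 1) => ((1 / (v : ℝ) : ℝ) : UnitAddCircle))) := by
  refine (theorem2p1_general v k hv).imp_right fun h d s hd hs hδ hpyr => ?_
  exact (h d s hd hs hδ hpyr).imp_left (And.imp_right fun hupper => by linarith)
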